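/- Theorem 7.2 (Main Theorem). Let $M$ be a monoid. An atom of $M$ is an element $a\neq 1$ such that $a=bc$ implies $b=1$ or $c=1$; $\|a\|$ denotes the supremum of the lengths of all expressions of $a$ as a product of atoms. Write $a\le_L b$ if $ac=b$ for some $c\in M$, and $a\le_R b$ if $ca=b$ for some $c\in M$. The monoid $M$ is a Garside monoid if it is generated by its atoms with $\|a\|<\infty$ for all $a\in M$, it is finitely generated, it is left and right cancellative, $(M,\le_L)$ and $(M,\le_R)$ are lattices, and there is $\Delta\in M$ such that $\{b: b\le_L\Delta\}=\{b: b\le_R\Delta\}$ and this set generates $M$. A Garside group is the group of fractions of a Garside monoid. For a finite set $X$ of semigroup generators of a group $G$, let $|g|_X$ be the length of a shortest word in the alphabet $X$ that represents $g$, and let $t_X(g)=\lim_{n\to\infty}|g^n|_X/n$ be the translation number of $g\in G$ with respect to $X$ (the limit exists by subadditivity). Let $G$ be a Garside group. Then $G$ is strongly translation discrete, that is, $G$ is finitely generated, and for every finite set $X$ of semigroup generators of $G$: 1. $t_X(g)>0$ for every $g\in G$ of infinite order; 2. for every real number $r$ there are only finitely many conjugacy classes of $G$ containing an element $g$ with $t_X(g)\le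 r$. -/

import Mathlib

open Filter Topology

namespace Garside

section Monoids

variable {M : Type*} [Monoid M]

/-- Atoms (indivisible elements) of a monoid. -/
def IsMonoidAtom (a : M) : Prop :=
  a ≠ 1 ∧ ∀ b c : M, a = b * c → b = 1 ∨ c = 1

/-- `‖a‖`: the supremum of the lengths of all expressions of `a` as a product of atoms. -/
noncomputable def atomNorm (a : M) : ℕ∞ :=
  ⨆ l : {l : List M // (∀ x ∈ l, IsMonoidAtom x) ∧ l.prod = a}, (l.1.length : ℕ∞)

/-- `a ≤_L b`: `a` is a prefix of `b`. -/
def LeL (a b : M) : Prop := ∃ c : M, a * c = b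

/-- `a ≤_R b`: `a` is a suffix of `b`. -/
def LeR (a b : M) : Prop := ∃ c : M, c * a = b

/-- The relation `r` is a partial order in which any two elements have a greatest lower bound
and a least upper bound. -/
structure IsLatticeOrder {α : Type*} (r : α → α → Prop) : Prop where
  refl : ∀ a, r a a
  trans : ∀ a b c, r a b → r b c → r a c
  antisymm : ∀ a b, r a b → r b a → a = b
  exists_inf : ∀ a b, ∃ d, r d a ∧ r d b ∧ ∀ x, r x a → r x b → r x d
  exists_sup : ∀ a b, ∃ m, r a m ∧ r b m ∧ ∀ x, r a x → r b x → r m x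

/-- A Garside element: its set of left divisors and its set of right divisors coincide and
generate the monoid. -/
def IsGarsideElement (Δ : M) : Prop :=
  {b : M | LeL b Δ} = {b : M | LeR b Δ} ∧ Submonoid.closure {b : M | LeL b Δ} = ⊤

variable (M) in
/-- An atomic monoid: generated by its atoms, and `‖a‖ < ∞` for every `a`. -/
structure IsAtomicMonoid : Prop where
  closure_atoms : Submonoid.closure {a : M | IsMonoidAtom a} = ⊤
  atomNorm_lt_top : ∀ a : M, atomNorm a < ⊤

variable (M) in
/-- Garside monoids. -/
structure IsGarsideMonoid : Prop where
  atomic : IsAtomicMonoid M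
  fg : Monoid.FG M
  mul_left_cancel : ∀ a b c : M, a * b = a * c → b = c
  mul_right_cancel : ∀ a b c : M, b * a = c * a → b = c
  lattice_left : IsLatticeOrder (LeL : M → M → Prop)
  lattice_right : IsLatticeOrder (LeR : M → M → Prop)
  exists_garsideElement : ∃ Δ : M, IsGarsideElement Δ

/-- `ι : M → G` makes the group `G` the group of (right) fractions of the monoid `M`, i.e. its
Ore localization at all of `M`: every element of `G` is a fraction `ι(a) ι(b)⁻¹`, and two elements
of `M` are identified in `G` only if they become equal after multiplication by some element of `M`.
(For cancellative `M` the second condition amounts to the injectivity of `ι`.) -/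
structure IsGroupOfFractions {G : Type*} [Group G] (ι : M →* G) : Prop where
  exists_fraction : ∀ g : G, ∃ a b : M, g = ι a * (ι b)⁻¹
  exists_of_eq : ∀ a b : M, ι a = ι b → ∃ c : M, a * c = b * c

end Monoids

section Translation

variable {G : Type*} [Group G]

/-- `X` is a set of semigroup generators of the group `G`: every element of `G` is a product of
elements of `X` (inverses are not used; the empty product is allowed, which matters only for the
trivial group). -/
def IsSemigroupGenerating (X : Set G) : Prop := Submonoid.closure X = ⊤

/-- `|g|_X`: the length of a shortest word in the alphabet `X` representing `g`. -/
noncomputable def wordLength (X : Set G) (g : G) : ℕ :=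
  sInf {n : ℕ | ∃ l : List G, (∀ x ∈ l, x ∈ X) ∧ l.prod = g ∧ l.length = n}

/-- The translation number `t_X(g) = lim |g ^ n|_X / n`. That the limit exists is shown in
`tendsto_translationNumber`. -/
noncomputable def translationNumber (X : Set G) (g : G) : ℝ :=
  limUnder atTop fun n : ℕ => (wordLength X (g ^ n) : ℝ) / n

theorem exists_word {X : Set G} (hX : IsSemigroupGenerating X) (g : G) :
    ∃ l : List G, (∀ x ∈ l, x ∈ X) ∧ l.prod = g ∧ l.length = wordLength X g := by
  have hne : {n : ℕ | ∃ l : List G, (∀ x ∈ l, x ∈ X) ∧ l.prod = g ∧ l.length = n}.Nonempty := by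
    have hg : g ∈ Submonoid.closure X := by
      rw [hX]
      trivial
    obtain ⟨l, hl, hp⟩ := Submonoid.exists_list_of_mem_closure hg
    exact ⟨l.length, l, hl, hp, rfl⟩
  exact Nat.sInf_mem hne

theorem wordLength_mul_le {X : Set G} (hX : IsSemigroupGenerating X) (g h : G) :
    wordLength X (g * h) ≤ wordLength X g + wordLength X h := by
  obtain ⟨l, hl, hlp, hln⟩ := exists_word hX g
  obtain ⟨m, hm, hmp, hmn⟩ := exists_word hX h
  refine Nat.sInf_le ⟨l ++ m, ?_, ?_, ?_⟩
  · intro x hx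
    rcases List.mem_append.1 hx with h1 | h1
    · exact hl x h1
    · exact hm x h1
  · rw [List.prod_append, hlp, hmp]
  · rw [List.length_append, hln, hmn]

/-- The limit defining the translation number exists. -/
theorem tendsto_translationNumber {X : Set G} (hX : IsSemigroupGenerating X) (g : G) :
    Tendsto (fun n : ℕ => (wordLength X (g ^ n) : ℝ) / n) atTop
      (𝓝 (translationNumber X g)) := by
  have hs : Subadditive fun n : ℕ => (wordLength X (g ^ n) : ℝ) := by
    intro m n
    simp only [pow_add]
    exact_mod_cast wordLength_mul_le hX (g ^ m) (g ^ n)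
  have hb : BddBelow (Set.range fun n : ℕ => (wordLength X (g ^ n) : ℝ) / n) := by
    refine ⟨0, ?_⟩
    rintro _ ⟨n, rfl⟩
    positivity
  exact tendsto_nhds_limUnder ⟨_, hs.tendsto_lim hb⟩

variable (G) in
/-- Translation separable groups. The condition is required for every finite set of semigroup
generators; since `G` is finitely generated, such sets exist. -/
structure IsTranslationSeparable : Prop where
  fg : Group.FG G
  pos : ∀ X : Set G, X.Finite → IsSemigroupGenerating X →
    ∀ g : G, ¬ IsOfFinOrder g → 0 < translationNumber X g

variable (G) in
/-- Strongly translation discrete groups: translation separable, and for every finite set `X` of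
semigroup generators and every real `r` only finitely many conjugacy classes have translation
number at most `r`. -/
structure IsStronglyTranslationDiscrete : Prop where
  separable : IsTranslationSeparable G
  finite_conjClasses : ∀ X : Set G, X.Finite → IsSemigroupGenerating X →
    ∀ r : ℝ, {c : ConjClasses G | ∃ g : G, ConjClasses.mk g = c ∧ translationNumber X g ≤ r}.Finite

end Translation

end Garside

namespace Garside

/-! ### Translation numbers in a group with a Garside cone -/

section PositiveCone

variable {G : Type*} [Group G]

/-! Order `G` by a ≤ b iff a⁻¹b ∈ P, where P is the image of `M`. This order is left-invariant with
binary meets, and a central power c of Δ has cofinal powers and finite intervals [1, c^k]. Since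
g^(±n) c^(K|g^n|) ≥ 1 for a constant K, a bound on t_X(g) gives g^k c^φ(k) ≥ 1 for all large |k|,
with φ of controlled growth. The meet h of these elements over all k is almost g-invariant: if
φ(k+i) ≤ φ(k)+d for all k, then h ≤ g^i c^d h (`exists_conj_zpow_mem`). For φ(k) = KR|k| with R > r,
this conjugates g into the finite interval [c^(-KR), c^(KR)], which leaves finitely many classes.
For φ(k) = ⌊|k|/N⌋, one h puts all h⁻¹g^i h with |i| ≤ N into [c⁻¹, c]. If N exceeds the size of
that interval, two of them coincide and g has finite order. -/

theorem mul_pow_mem_of_le {P : Submonoid G} {c : G} (hc : c ∈ P) {g : G} {k l : ℕ} (hkl : k ≤ l)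
    (h : g * c ^ k ∈ P) : g * c ^ l ∈ P := by
  obtain ⟨m, rfl⟩ := Nat.exists_eq_add_of_le hkl
  rw [pow_add, ← mul_assoc]
  exact P.mul_mem h (P.pow_mem hc m)

/-- A submonoid `P` of a group with a central element `c` such that the left-invariant relation
`a⁻¹ * b ∈ P` has binary meets, the powers of `c` are cofinal and the intervals `[1, c ^ k]` are
finite. -/
structure IsGarsideCone (P : Submonoid G) (c : G) : Prop where
  mem : c ∈ P
  central : ∀ x : G, Commute c x
  exists_mul_pow_mem : ∀ g : G, ∃ k : ℕ, g * c ^ k ∈ P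
  finite_interval : ∀ k : ℕ, {x : G | x ∈ P ∧ x⁻¹ * c ^ k ∈ P}.Finite
  exists_inf : ∀ a b : G, ∃ d : G, d⁻¹ * a ∈ P ∧ d⁻¹ * b ∈ P ∧
    ∀ x : G, x⁻¹ * a ∈ P → x⁻¹ * b ∈ P → x⁻¹ * d ∈ P

namespace IsGarsideCone

variable {P : Submonoid G} {c : G}

theorem mul_mul_pow_add_mem (hP : IsGarsideCone P c) {g h : G} {k l : ℕ}
    (hg : g * c ^ k ∈ P) (hh : h * c ^ l ∈ P) : g * h * c ^ (k + l) ∈ P := by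
  have e : g * h * c ^ (k + l) = g * c ^ k * (h * c ^ l) := by
    rw [pow_add, mul_assoc g (c ^ k), ← mul_assoc (c ^ k) h, ((hP.central h).pow_left k).eq]
    simp only [mul_assoc]
  rw [e]
  exact P.mul_mem hg hh

theorem exists_finset_inf (hP : IsGarsideCone P c) {α : Type*} (f : α → G) {s : Finset α}
    (hs : s.Nonempty) : ∃ d : G, (∀ k ∈ s, d⁻¹ * f k ∈ P) ∧
      ∀ x : G, (∀ k ∈ s, x⁻¹ * f k ∈ P) → x⁻¹ * d ∈ P := by
  induction hs using Finset.Nonempty.cons_induction with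
  | singleton a => exact ⟨f a, by simp [P.one_mem], fun x hx => hx a (by simp)⟩
  | cons a s ha hs ih =>
    obtain ⟨d, hd, hd'⟩ := ih
    obtain ⟨e, hea, hed, he⟩ := hP.exists_inf (f a) d
    refine ⟨e, fun k hk => ?_, fun x hx => ?_⟩
    · rcases Finset.mem_cons.1 hk with rfl | hk
      · exact hea
      · simpa [mul_assoc] using P.mul_mem hed (hd k hk)
    · exact he x (hx a (by simp)) (hd' x fun k hk => hx k (by simp [hk]))

/-- The meet `h` of all `g ^ k * c ^ φ k` conjugates the powers of `g` above powers of `c⁻¹`,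
simultaneously. -/
theorem exists_conj_zpow_mem (hP : IsGarsideCone P c) (g : G) (φ : ℤ → ℕ) (h0 : φ 0 = 0) (k₀ : ℕ)
    (hφ : ∀ k : ℤ, k₀ ≤ k.natAbs → g ^ k * c ^ φ k ∈ P) :
    ∃ h : G, ∀ (i : ℤ) (d : ℕ), (∀ k, φ (k + i) ≤ φ k + d) → h⁻¹ * g ^ i * h * c ^ d ∈ P := by
  have hs0 : (0 : ℤ) ∈ Finset.Icc (-k₀ : ℤ) k₀ := by simp
  -- A finite window suffices: outside it the terms are ≥ 1, which is the term at k = 0.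
  obtain ⟨h, hle, hinf⟩ := hP.exists_finset_inf (fun k : ℤ => g ^ k * c ^ φ k) ⟨0, hs0⟩
  have hone : h⁻¹ ∈ P := by simpa [h0] using hle 0 hs0
  have hall : ∀ k : ℤ, h⁻¹ * (g ^ k * c ^ φ k) ∈ P := by
    intro k
    by_cases hk : k₀ ≤ k.natAbs
    · exact P.mul_mem hone (hφ k hk)
    · exact hle k (Finset.mem_Icc.2 (by omega))
  refine ⟨h, fun i d hd => ?_⟩
  -- Multiplying the k-th term by g^i c^d gives an element above the (k+i)-th term, so (g^i c^d)⁻¹h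
  -- is again a lower bound.
  have key : ((g ^ i * c ^ d)⁻¹ * h)⁻¹ * h ∈ P := by
    refine hinf _ fun k _ => ?_
    have e : ((g ^ i * c ^ d)⁻¹ * h)⁻¹ * (g ^ k * c ^ φ k)
        = h⁻¹ * g ^ (k + i) * c ^ (φ k + d) := by
      rw [add_comm k i, zpow_add, add_comm (φ k), pow_add, mul_inv_rev, inv_inv]
      have := ((hP.central (g ^ k)).pow_left d).eq
      simp only [mul_assoc]
      rw [← mul_assoc (c ^ d) (g ^ k), this, mul_assoc]
    rw [e]
    exact mul_pow_mem_of_le hP.mem (hd k) (by simpa [mul_assoc] using hall (k + i))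
  have e : ((g ^ i * c ^ d)⁻¹ * h)⁻¹ * h = h⁻¹ * g ^ i * h * c ^ d := by
    have := ((hP.central h).pow_left d).eq
    rw [mul_inv_rev, inv_inv]
    simp only [mul_assoc]
    rw [this]
  rwa [e] at key

/-- The elements lying between `c ^ (-d)` and `c ^ d` are finite in number. -/
theorem finite_symm_interval (hP : IsGarsideCone P c) (d : ℕ) :
    {x : G | x * c ^ d ∈ P ∧ x⁻¹ * c ^ d ∈ P}.Finite := by
  refine ((hP.finite_interval (d + d)).preimage (f := fun x => x * c ^ d)
    (mul_left_injective _).injOn).subset ?_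
  rintro x ⟨h1, h2⟩
  refine ⟨h1, ?_⟩
  have e : (x * c ^ d)⁻¹ * c ^ (d + d) = x⁻¹ * c ^ d := by
    have := ((hP.central x⁻¹).pow_left d).eq
    have h2 := ((hP.central x).pow_left d).eq
    rw [pow_add, ← h2, mul_inv_rev]
    group
  rw [e]
  exact h2

/-- Each letter costs a bounded power of c, and these powers add up because c is central. -/
theorem exists_wordLength_bound (hP : IsGarsideCone P c) {X : Set G} (hfin : X.Finite)
    (hX : IsSemigroupGenerating X) :
    ∃ K : ℕ, ∀ g : G, g * c ^ (K * wordLength X g) ∈ P ∧ g⁻¹ * c ^ (K * wordLength X g) ∈ P := by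
  have hk : ∀ x : G, ∃ k : ℕ, x * c ^ k ∈ P ∧ x⁻¹ * c ^ k ∈ P := fun x => by
    obtain ⟨k, hk⟩ := hP.exists_mul_pow_mem x
    obtain ⟨l, hl⟩ := hP.exists_mul_pow_mem x⁻¹
    exact ⟨max k l, mul_pow_mem_of_le hP.mem (le_max_left k l) hk,
      mul_pow_mem_of_le hP.mem (le_max_right k l) hl⟩
  choose k hk hk' using hk
  refine ⟨hfin.toFinset.sup k, fun g => ?_⟩
  obtain ⟨l, hl, rfl, hlen⟩ := exists_word hX g
  rw [← hlen]
  clear hlen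
  induction l with
  | nil => simp [P.one_mem]
  | cons x l ih =>
    have hx : k x ≤ hfin.toFinset.sup k :=
      Finset.le_sup (hfin.mem_toFinset.2 (hl x (by simp)))
    obtain ⟨h1, h2⟩ := ih fun y hy => hl y (by simp [hy])
    rw [List.prod_cons, List.length_cons, mul_add_one, mul_inv_rev]
    refine ⟨?_, hP.mul_mul_pow_add_mem h2 (mul_pow_mem_of_le hP.mem hx (hk' x))⟩
    rw [add_comm]
    exact hP.mul_mul_pow_add_mem (mul_pow_mem_of_le hP.mem hx (hk x)) h1

theorem exists_wordLength_pow_le {X : Set G} (hX : IsSemigroupGenerating X) {g : G} {r : ℝ}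
    (h : translationNumber X g < r) :
    ∃ k₀ : ℕ, ∀ n ≥ k₀, (wordLength X (g ^ n) : ℝ) ≤ r * n := by
  have h1 := ((tendsto_translationNumber hX g).eventually_lt_const h).and (eventually_gt_atTop 0)
  obtain ⟨k₀, hk₀⟩ := eventually_atTop.1 h1
  refine ⟨k₀, fun n hn => ?_⟩
  obtain ⟨h2, h3⟩ := hk₀ n hn
  rw [div_lt_iff₀ (by exact_mod_cast h3)] at h2
  exact h2.le

theorem zpow_mul_pow_mem (hP : IsGarsideCone P c) {X : Set G} {K : ℕ}
    (hK : ∀ g : G, g * c ^ (K * wordLength X g) ∈ P ∧ g⁻¹ * c ^ (K * wordLength X g) ∈ P)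
    (g : G) (k : ℤ) {m : ℕ} (hm : K * wordLength X (g ^ k.natAbs) ≤ m) : g ^ k * c ^ m ∈ P := by
  refine mul_pow_mem_of_le hP.mem hm ?_
  rcases Int.natAbs_eq k with h | h
  · have e : g ^ k = g ^ k.natAbs := by rw [← zpow_natCast, ← h]
    rw [e]
    exact (hK _).1
  · have e : g ^ k = (g ^ k.natAbs)⁻¹ := by rw [← zpow_natCast, ← zpow_neg, ← h]
    rw [e]
    exact (hK _).2

theorem translationNumber_pos (hP : IsGarsideCone P c) {X : Set G} (hfin : X.Finite)
    (hX : IsSemigroupGenerating X) {g : G} (hg : ¬ IsOfFinOrder g) :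
    0 < translationNumber X g := by
  by_contra ht
  obtain ⟨K, hK⟩ := hP.exists_wordLength_bound hfin hX
  let F := (hP.finite_symm_interval 1).toFinset
  let N := F.card + 1
  -- This rate yields K|g^n| ≤ ⌊n/N⌋ for large n; the +1 covers K = 0.
  obtain ⟨k₀, hk₀⟩ := exists_wordLength_pow_le hX (g := g) (r := 1 / (K * N + 1))
    ((not_lt.1 ht).trans_lt (by positivity))
  obtain ⟨h, hh⟩ := hP.exists_conj_zpow_mem g (fun k => k.natAbs / N) (by simp) k₀ fun k hk => by
    refine hP.zpow_mul_pow_mem hK g k ((Nat.le_div_iff_mul_le (Nat.succ_pos _)).2 ?_)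
    have h1 := hk₀ _ hk
    rw [one_div, inv_mul_eq_div, le_div_iff₀ (by positivity)] at h1
    have h2 : wordLength X (g ^ k.natAbs) * (K * N + 1) ≤ k.natAbs := by exact_mod_cast h1
    calc K * wordLength X (g ^ k.natAbs) * N = wordLength X (g ^ k.natAbs) * (K * N) := by ring
      _ ≤ wordLength X (g ^ k.natAbs) * (K * N + 1) := Nat.mul_le_mul_left _ (Nat.le_succ _)
      _ ≤ k.natAbs := h2
  have hstep : ∀ i : ℤ, i.natAbs ≤ N → h⁻¹ * g ^ i * h * c ^ 1 ∈ P := fun i hi => by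
    refine hh i 1 fun k => ?_
    rw [← Nat.add_div_right _ (Nat.succ_pos _)]
    exact Nat.div_le_div_right ((Int.natAbs_add_le k i).trans (Nat.add_le_add_left hi _))
  obtain ⟨i, -, j, -, hij, he⟩ := Finset.exists_ne_map_eq_of_card_lt_of_maps_to
    (s := Finset.range N) (t := F) (by simp [N]) (f := fun i => h⁻¹ * g ^ i * h) (by
      intro i hi
      have hi' : i < N := by simpa using hi
      refine (hP.finite_symm_interval 1).mem_toFinset.2 ⟨?_, ?_⟩
      · simpa using hstep i (by simpa using hi'.le)
      · simpa [mul_assoc] using hstep (-i) (by simpa using hi'.le))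
  exact hij (injective_pow_iff_not_isOfFinOrder.2 hg (by simpa using he))

theorem finite_conjClasses (hP : IsGarsideCone P c) {X : Set G} (hfin : X.Finite)
    (hX : IsSemigroupGenerating X) (r : ℝ) :
    {a : ConjClasses G | ∃ g : G, ConjClasses.mk g = a ∧ translationNumber X g ≤ r}.Finite := by
  obtain ⟨K, hK⟩ := hP.exists_wordLength_bound hfin hX
  obtain ⟨R, hR⟩ := exists_nat_gt r
  refine ((hP.finite_symm_interval (K * R)).image ConjClasses.mk).subset ?_
  rintro _ ⟨g, rfl, hg⟩
  obtain ⟨k₀, hk₀⟩ := exists_wordLength_pow_le hX (hg.trans_lt hR)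
  obtain ⟨h, hh⟩ := hP.exists_conj_zpow_mem g (fun k => K * R * k.natAbs) (by simp) k₀
    fun k hk => by
      refine hP.zpow_mul_pow_mem hK g k ?_
      rw [mul_assoc]
      exact Nat.mul_le_mul_left K (by exact_mod_cast hk₀ _ hk)
  have hstep : ∀ i : ℤ, i.natAbs ≤ 1 → h⁻¹ * g ^ i * h * c ^ (K * R) ∈ P := fun i hi => by
    refine hh i _ fun k => ?_
    rw [← mul_add_one]
    exact Nat.mul_le_mul_left _ ((Int.natAbs_add_le k i).trans (Nat.add_le_add_left hi _))
  refine ⟨h⁻¹ * g * h, ⟨by simpa using hstep 1 (by simp), ?_⟩, ?_⟩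
  · simpa [mul_assoc] using hstep (-1) (by simp)
  · exact ConjClasses.mk_eq_mk_iff_isConj.2 (isConj_iff.2 ⟨h, by group⟩)

end IsGarsideCone

end PositiveCone

/-! ### From Garside monoids to Garside cones -/

section Monoids

variable {M : Type*} [Monoid M]

theorem mem_of_isMonoidAtom_prod {a : M} (ha : IsMonoidAtom a) :
    ∀ l : List M, l.prod = a → a ∈ l
  | [], h => absurd h.symm ha.1
  | x :: l, h => by
    rw [List.prod_cons] at h
    rcases ha.2 x l.prod h.symm with h1 | h1
    · rw [h1, one_mul] at h
      exact List.mem_cons_of_mem _ (mem_of_isMonoidAtom_prod ha l h)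
    · rw [h1, mul_one] at h
      simp [h]

theorem finite_atoms (hfg : Monoid.FG M) : {a : M | IsMonoidAtom a}.Finite := by
  obtain ⟨S, hS⟩ := hfg.fg_top
  refine S.finite_toSet.subset fun a ha => ?_
  obtain ⟨l, hl, hp⟩ := Submonoid.exists_list_of_mem_closure
    (show a ∈ Submonoid.closure (S : Set M) by rw [hS]; trivial)
  exact hl a (mem_of_isMonoidAtom_prod ha l hp)

namespace IsGarsideMonoid

theorem exists_atom_list (hM : IsGarsideMonoid M) (a : M) :
    ∃ l : List M, (∀ x ∈ l, IsMonoidAtom x) ∧ l.prod = a :=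
  Submonoid.exists_list_of_mem_closure
    (show a ∈ Submonoid.closure {a : M | IsMonoidAtom a} by rw [hM.atomic.closure_atoms]; trivial)

theorem length_le_atomNorm {l : List M} (hl : ∀ x ∈ l, IsMonoidAtom x) :
    (l.length : ℕ∞) ≤ atomNorm l.prod :=
  le_iSup (fun m : {m : List M // (∀ x ∈ m, IsMonoidAtom x) ∧ m.prod = l.prod} =>
    (m.1.length : ℕ∞)) ⟨l, hl, rfl⟩

/-- A prefix of b is a product of at most ‖b‖ atoms, and there are finitely many atoms. -/
theorem finite_leL (hM : IsGarsideMonoid M) (b : M) : {a : M | LeL a b}.Finite := by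
  obtain ⟨n, hn⟩ := ENat.ne_top_iff_exists.1 (hM.atomic.atomNorm_lt_top b).ne
  have : Finite {a : M | IsMonoidAtom a} := finite_atoms hM.fg
  refine ((List.finite_length_le {a : M | IsMonoidAtom a} n).image
    fun l => (l.map Subtype.val).prod).subset ?_
  rintro a ⟨d, rfl⟩
  obtain ⟨l, hl, rfl⟩ := hM.exists_atom_list a
  obtain ⟨m, hm, rfl⟩ := hM.exists_atom_list d
  have h := length_le_atomNorm (l := l ++ m) fun x hx =>
    (List.mem_append.1 hx).elim (hl x) (hm x)
  rw [List.prod_append, ← hn, Nat.cast_le, List.length_append] at h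
  refine ⟨l.attach.map fun x => ⟨x.1, hl x.1 x.2⟩, ?_, ?_⟩
  · simp only [Set.mem_ofPred_eq, List.length_map, List.length_attach]
    omega
  · simp [Function.comp_def]

theorem injective (hM : IsGarsideMonoid M) {G : Type*} [Group G] {ι : M →* G}
    (hι : IsGroupOfFractions ι) : Function.Injective ι := fun a b h => by
  obtain ⟨d, hd⟩ := hι.exists_of_eq a b h
  exact hM.mul_right_cancel d a b hd

/-- Some positive power of a Garside element is central. -/
theorem exists_pow_central (hM : IsGarsideMonoid M) {Δ : M} (hΔ : IsGarsideElement Δ) :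
    ∃ e : ℕ, 0 < e ∧ ∀ m : M, Commute (Δ ^ e) m := by
  -- If ab = Δ, then b is a suffix, hence a prefix: ba' = Δ and aΔ = aba' = Δa'. The map a ↦ a'
  -- permutes the finite set of divisors, and its order is the required exponent.
  have hconj : ∀ a : {b : M | LeL b Δ}, ∃ a' : {b : M | LeL b Δ}, a.1 * Δ = Δ * a'.1 := by
    rintro ⟨a, b, hab⟩
    have hb : b ∈ {b : M | LeL b Δ} := by
      rw [hΔ.1]
      exact ⟨a, hab⟩
    obtain ⟨a', ha'⟩ := hb
    have : a' ∈ {b : M | LeL b Δ} := by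
      rw [hΔ.1]
      exact ⟨b, ha'⟩
    have h : a * Δ = Δ * a' := by
      calc a * Δ = a * (b * a') := by rw [ha']
        _ = Δ * a' := by rw [← mul_assoc, hab]
    exact ⟨⟨a', this⟩, h⟩
  choose τ hτ using hconj
  have : Finite {b : M | LeL b Δ} := hM.finite_leL Δ
  have hinj : Function.Injective τ := fun x y hxy => by
    refine Subtype.ext (hM.mul_right_cancel Δ x.1 y.1 ?_)
    rw [hτ, hτ, hxy]
  have hpow : ∀ (n : ℕ) (a : {b : M | LeL b Δ}), a.1 * Δ ^ n = Δ ^ n * (τ^[n] a).1 := by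
    intro n
    induction n with
    | zero => simp
    | succ n ih =>
      intro a
      rw [Function.iterate_succ_apply', pow_succ, ← mul_assoc, ih, mul_assoc, hτ, mul_assoc]
  let σ := Equiv.ofBijective τ (Finite.injective_iff_bijective.1 hinj)
  refine ⟨orderOf σ, orderOf_pos σ, fun m => ?_⟩
  have hid : τ^[orderOf σ] = id := by
    have h := congrArg (fun p : Equiv.Perm _ => (p : _ → _)) (pow_orderOf_eq_one σ)
    rw [Equiv.Perm.coe_pow] at h
    exact h
  have hm : m ∈ Submonoid.closure {b : M | LeL b Δ} := by
    rw [hΔ.2]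
    trivial
  induction hm using Submonoid.closure_induction with
  | mem x hx =>
    have := hpow (orderOf σ) ⟨x, hx⟩
    rw [hid] at this
    exact this.symm
  | one => exact Commute.one_right _
  | mul x y _ _ hx hy => exact hx.mul_right hy

variable {G : Type*} [Group G] {ι : M →* G}

theorem leL_iff (hM : IsGarsideMonoid M) (hι : IsGroupOfFractions ι) {a b : M} :
    LeL a b ↔ (ι a)⁻¹ * ι b ∈ MonoidHom.mrange ι := by
  constructor
  · rintro ⟨d, rfl⟩
    exact ⟨d, by simp⟩
  · rintro ⟨d, hd⟩
    exact ⟨d, hM.injective hι (by simp [hd])⟩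

/-- Left multiplication preserves greatest lower bounds in the prefix order. -/
theorem leL_mul_of_forall (hM : IsGarsideMonoid M) {a b d : M}
    (hd : ∀ x, LeL x a → LeL x b → LeL x d) (m : M) {x : M} (ha : LeL x (m * a))
    (hb : LeL x (m * b)) : LeL x (m * d) := by
  obtain ⟨e, hea, heb, he⟩ := hM.lattice_left.exists_inf (m * a) (m * b)
  obtain ⟨f, rfl⟩ := he m ⟨a, rfl⟩ ⟨b, rfl⟩
  have hcancel : ∀ y, LeL (m * f) (m * y) → LeL f y := fun y ⟨z, hz⟩ =>
    ⟨z, hM.mul_left_cancel m _ _ (by rw [← hz, mul_assoc])⟩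
  obtain ⟨z, hz⟩ := hd f (hcancel a hea) (hcancel b heb)
  refine hM.lattice_left.trans _ _ _ (he x ha hb) ⟨z, ?_⟩
  rw [mul_assoc, hz]

theorem exists_isGarsideCone (hM : IsGarsideMonoid M) (hι : IsGroupOfFractions ι) :
    ∃ c : G, IsGarsideCone (MonoidHom.mrange ι) c := by
  obtain ⟨Δ, hΔ⟩ := hM.exists_garsideElement
  obtain ⟨e, he, hcomm⟩ := hM.exists_pow_central hΔ
  have hmem : ∀ m, ι m ∈ MonoidHom.mrange ι := fun m => ⟨m, rfl⟩
  have hcent : ∀ x : G, Commute (ι (Δ ^ e)) x := fun x => by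
    obtain ⟨a, b, rfl⟩ := hι.exists_fraction x
    exact ((hcomm a).map ι).mul_right ((hcomm b).map ι).inv_right
  have hinv : ∀ m : M, ∃ k : ℕ, (ι m)⁻¹ * ι (Δ ^ e) ^ k ∈ MonoidHom.mrange ι := fun m => by
    have hm : m ∈ Submonoid.closure {b : M | LeL b Δ} := by
      rw [hΔ.2]
      trivial
    induction hm using Submonoid.closure_induction with
    | mem x hx =>
      obtain ⟨y, hy⟩ := hx
      refine ⟨1, y * Δ ^ (e - 1), ?_⟩
      rw [pow_one, ← mul_pow_sub_one he.ne', ← hy]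
      simp [mul_assoc]
    | one => exact ⟨0, by simp⟩
    | mul x y _ _ hx hy =>
      obtain ⟨k, hk⟩ := hx
      obtain ⟨l, hl⟩ := hy
      refine ⟨k + l, ?_⟩
      have h := Submonoid.mul_mem _ hl hk
      rw [mul_assoc, ← mul_assoc _ (ι x)⁻¹, ((hcent (ι x)⁻¹).pow_left l).eq] at h
      rw [map_mul, mul_inv_rev, add_comm, pow_add]
      simpa only [mul_assoc] using h
  have hcof : ∀ g : G, ∃ k : ℕ, g * ι (Δ ^ e) ^ k ∈ MonoidHom.mrange ι := fun g => by
    obtain ⟨a, b, rfl⟩ := hι.exists_fraction g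
    obtain ⟨k, hk⟩ := hinv b
    exact ⟨k, by simpa only [mul_assoc] using Submonoid.mul_mem _ (hmem a) hk⟩
  refine ⟨ι (Δ ^ e), hmem _, hcent, hcof, fun k => ?_, fun a b => ?_⟩
  · refine ((hM.finite_leL ((Δ ^ e) ^ k)).image ι).subset ?_
    rintro _ ⟨⟨m, rfl⟩, h⟩
    exact ⟨m, (hM.leL_iff hι).2 (by rwa [map_pow]), rfl⟩
  · obtain ⟨k, hk⟩ := hcof a
    obtain ⟨l, hl⟩ := hcof b
    obtain ⟨a', ha'⟩ := mul_pow_mem_of_le (hmem _) (le_max_left k l) hk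
    obtain ⟨b', hb'⟩ := mul_pow_mem_of_le (hmem _) (le_max_right k l) hl
    obtain ⟨d, hda, hdb, hd⟩ := hM.lattice_left.exists_inf a' b'
    generalize max k l = n at ha' hb'
    have hle : ∀ (x y : G) (j : ℕ) (m m' : M), ι m = x * ι (Δ ^ e) ^ j →
        ι m' = y * ι (Δ ^ e) ^ j → (x⁻¹ * y ∈ MonoidHom.mrange ι ↔ LeL m m') := by
      intro x y j m m' hm hm'
      rw [hM.leL_iff hι, hm, hm', ← ((hcent x).pow_left j).eq, ← ((hcent y).pow_left j).eq]
      simp [mul_assoc]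
    have hd' : ι d = ι d * (ι (Δ ^ e) ^ n)⁻¹ * ι (Δ ^ e) ^ n := by simp
    refine ⟨ι d * (ι (Δ ^ e) ^ n)⁻¹, (hle _ _ n _ _ hd' ha').2 hda,
      (hle _ _ n _ _ hd' hb').2 hdb, fun x hxa hxb => ?_⟩
    -- A lower bound x may need a larger power of c to enter the image of `M`, so meets must survive
    -- multiplication by Δ^(ej); this is `leL_mul_of_forall`.
    obtain ⟨j, hj⟩ := hcof x
    obtain ⟨m, hm⟩ := mul_pow_mem_of_le (hmem _) (Nat.le_add_left j n) hj
    have hadd : ∀ (y : G) (m' : M), ι m' = y * ι (Δ ^ e) ^ n →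
        ι ((Δ ^ e) ^ j * m') = y * ι (Δ ^ e) ^ (n + j) := fun y m' h => by
      rw [map_mul, map_pow, h, ((hcent _).pow_left j).eq, pow_add, mul_assoc]
    exact (hle _ _ _ _ _ hm (hadd _ _ hd')).2 (hM.leL_mul_of_forall hd _
      ((hle _ _ _ _ _ hm (hadd _ _ ha')).1 hxa) ((hle _ _ _ _ _ hm (hadd _ _ hb')).1 hxb))

theorem group_fg (hM : IsGarsideMonoid M) (hι : IsGroupOfFractions ι) : Group.FG G := by
  obtain ⟨S, hS⟩ := hM.fg.fg_top
  refine Group.fg_iff.2 ⟨ι '' S, eq_top_iff.2 fun g _ => ?_, S.finite_toSet.image ι⟩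
  have hmem : ∀ m, ι m ∈ Subgroup.closure (ι '' S) := fun m =>
    Subgroup.le_closure_toSubmonoid _ (by
      rw [← MonoidHom.map_mclosure, hS]
      exact ⟨m, trivial, rfl⟩)
  obtain ⟨a, b, rfl⟩ := hι.exists_fraction g
  exact mul_mem (hmem a) (inv_mem (hmem b))

end IsGarsideMonoid

end Monoids

end Garside

theorem theorem7p2 {M : Type*} {G : Type*} [Monoid M] [Group G]
    (hM : Garside.IsGarsideMonoid M) (ι : M →* G) (hι : Garside.IsGroupOfFractions ι) :
    Garside.IsStronglyTranslationDiscrete G := by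
  obtain ⟨c, hc⟩ := hM.exists_isGarsideCone hι
  exact ⟨⟨hM.group_fg hι, fun X hfin hX g hg => hc.translationNumber_pos hfin hX hg⟩,
    fun X hfin hX r => hc.finite_conjClasses hfin hX r⟩
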